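/- Fix real numbers $\mu>0$ and $0<b<\frac1{\sqrt2}$. Let $M=\mathbb R\times\mathbb S^1$ with $\mathbb S^1=\mathbb R/2\mathbb Z$ (i.e. $[-1,1]$ with its ends identified), with the measure $dt\,dx$, and let $T_{a,\theta}(t,x)=(t+a,x+\theta)$ for $(a,\theta)\in\mathbb R\times\mathbb S^1$. **Correlators.** For $\operatorname{Re}\tau\ge0$ and $x\in\mathbb S^1$ let (principal branch of $\log$) $$g(\tau,x)=-\tfrac{\pi\tau}{2}-\tfrac12\log(1-e^{-\pi\tau+\pi ix})-\tfrac12\log(1-e^{-\pi\tau-\pi ix}).$$ For $u_j=(t_j,x_j)\in M$, $1\le j\le k$, put $v_j=(it_j,x_j)$ and let $\gamma$ be the piecewise linear contour in $\mathbb C$, parametrized by $s\in\mathbb R$, that comes in horizontally from $it_1-\infty$ to $it_1$, moves vertically to $it_2$, then to $it_3,\dots,it_k$, and leaves horizontally to $it_k+\infty$. The point $v_j$ is regarded as the $j$-th marked visit of $\gamma$, and $\mathcal T(u-u')$ denotes the difference of two insertions or points of $\gamma\times\mathbb S^1$ taken as "later minus earlier" along $\gamma$, insertions being ordered by their labels.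 For $\alpha_j\in\mathbb C$ and $w=-b^{-1}\sum_j\alpha_j\in\mathbb Z_{\ge0}$ put $$C^{\mathrm L}_{\alpha_1,\dots,\alpha_k}(u_1,\dots,u_k)=\frac{(-\mu)^w}{w!}\exp\Bigl(-4\sum_{i<j}\alpha_i\alpha_j\,g(\mathcal T(v_i-v_j))\Bigr)\int_{(\gamma\times[-1,1])^w}\exp\Bigl(-4b\sum_{j,l}\alpha_j\,g(\mathcal T(v_j-z_l))-4b^2\sum_{l<l'}g(\mathcal T(z_l-z_{l'}))\Bigr)dz_1\cdots dz_w,$$ where $dz_l=\gamma'(s_l)\,ds_l\,dy_l$ at $z_l=(\gamma(s_l),y_l)$; for $w\in\mathbb Z_{<0}$ put $C^{\mathrm L}\equiv0$. (Empty sums are $0$; empty products and $0$-fold integrals are $1$.) **The algebra and the vacuum functional.** Let $\mathcal F=C_c^\infty(M,\mathbb C)$, $\mathcal I_b=\{n\in\mathbb Z:|n|<\frac1{\sqrt2\,b}\}$, and let $\mathcal A$ be the complex unital tensor algebra of $\bigoplus_{n\in\mathcal I_b}\mathcal F$, where $\mathcal O_{f,n}$ denotes the generator given by $f\in\mathcal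 F$ in the $n$-th summand. It carries the conjugate-linear anti-multiplicative involution with $1^*=1$, $\mathcal O_{f,n}^*=\mathcal O_{\bar f,n}$. Let $\omega:\mathcal A\to\mathbb C$ be the linear functional with $\omega(1)=1$ and $$\omega(\mathcal O_{f_1,n_1}\cdots\mathcal O_{f_k,n_k})=\int_{M^k}\prod_{j=1}^kf_j(u_j)\;C^{\mathrm L}_{bn_1,\dots,bn_k}(u_1,\dots,u_k)\,du_1\cdots du_k .$$ (These integrals converge absolutely for $0<b<\frac1{\sqrt2}$; by convention $\omega$ is set to zero on the monomials of a charge tuple $(n_1,\dots,n_k)$ should one of its integrals fail to converge.) Let $\eta_{a,\theta}:\mathcal A\to\mathcal A$ be the unital algebra homomorphism with $\eta_{a,\theta}\mathcal O_{f,n}=\mathcal O_{f\circ T_{-a,-\theta},\,n}$. For an open set $O\subset M$, let $\mathcal A(O)$ be the unital $*$-subalgebra of $\mathcal A$ generated by all $\mathcal O_{f,n}$ with $\operatorname{supp} f\subset O$. **Proposition (AQFT-type net on the cylinder).** 1. $(\eta_{a,\theta})$ is an action of the group $\mathbb R\times\mathbb S^1$ on $\mathcal A$ by $*$-automorphisms: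 $\eta_{0,0}=\mathrm{id}$, $\eta_{a+a',\theta+\theta'}=\eta_{a,\theta}\eta_{a',\theta'}$, and each $\eta_{a,\theta}$ is a bijective unital algebra homomorphism with $\eta_{a,\theta}(A^*)=(\eta_{a,\theta}A)^*$ for all $A\in\mathcal A$. 2. $\omega(\eta_{a,\theta}A)=\omega(A)$ for all $(a,\theta)\in\mathbb R\times\mathbb S^1$ and $A\in\mathcal A$. 3. If $O_1\subset O_2$ are open subsets of $M$, then $\mathcal A(O_1)\subset\mathcal A(O_2)$. 4. $\eta_{a,\theta}\mathcal A(O)=\mathcal A(T_{a,\theta}O)$ for all $(a,\theta)\in\mathbb R\times\mathbb S^1$ and all open $O\subset M$. 5. For each open $O\subset M$ the restriction $\omega_O=\omega|_{\mathcal A(O)}$ is a normalized Hermitian functional: it is linear, $\omega_O(1)=1$, and $\omega_O(A^*)=\overline{\omega_O(A)}$ for all $A\in\mathcal A(O)$. -/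

import Mathlib

open scoped ContDiff DirectSum

noncomputable section

namespace TimelikeLiouville

/-! ### The cylinder and its translations -/

instance factTwoPos : Fact ((0 : ℝ) < 2) := ⟨two_pos⟩

/-- The cylinder `M = ℝ × 𝕊¹`, where `𝕊¹ = ℝ / 2ℤ` is the interval `[-1, 1]` with its ends
identified. A point is `(t, x)` with `t` the time and `x` the position. As an additive group it is
also the group of cylinder translations, and its volume is Lebesgue measure `dt dx`
(the circle has total length `2`). -/
abbrev Cyl : Type := ℝ × AddCircle (2 : ℝ)

/-- The translation `T_{a,θ} (t, x) = (t + a, x + θ)`. -/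
def translate (p u : Cyl) : Cyl := (u.1 + p.1, u.2 + p.2)

/-! ### The Green's function and the Lorentzian correlators -/

/-- The continued Green's function
`g(τ, x) = -πτ/2 - ½ log (1 - e^{-πτ + πix}) - ½ log (1 - e^{-πτ - πix})`, principal branch,
used for `Re τ ≥ 0`. For `x : ℝ / 2ℤ` the number `e^{πix}` is `AddCircle.toCircle x`. -/
def green (τ : ℂ) (x : AddCircle (2 : ℝ)) : ℂ :=
  -(Real.pi * τ / 2)
    - Complex.log (1 - Complex.exp (-(Real.pi * τ)) * (AddCircle.toCircle x : ℂ)) / 2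
    - Complex.log (1 - Complex.exp (-(Real.pi * τ)) * (AddCircle.toCircle (-x) : ℂ)) / 2

/-- The green function of `z - z'`, a difference of two points of `ℂ × 𝕊¹`
of which `z` is the later one. -/
def greenDiff (z z' : ℂ × AddCircle (2 : ℝ)) : ℂ := green (z.1 - z'.1) (z.2 - z'.2)

/-- The `j`-th entry of `t = (t_0, …, t_{k-1})` (and `0` when `j` is not an index). -/
def visit {k : ℕ} (t : Fin k → ℝ) (j : ℕ) : ℝ := if h : j < k then t ⟨j, h⟩ else 0

/-- The contour `γ` of the times `t_0, …, t_{k-1}`, with a piecewise linear parametrization: for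
`s ≤ 0` it comes in horizontally from `i t_0 - ∞` to `i t_0`, for `j ≤ s ≤ j + 1` it moves
vertically from `i t_j` to `i t_{j+1}`, and for `s ≥ k - 1` it leaves horizontally from
`i t_{k-1}` to `i t_{k-1} + ∞`. It visits `i t_j` at the parameter `s = j`. -/
def contour {k : ℕ} (t : Fin k → ℝ) (s : ℝ) : ℂ :=
  ((min s 0 + max (s - ((k : ℝ) - 1)) 0 : ℝ) : ℂ)
    + Complex.I * ((visit t 0 + ∑ j ∈ Finset.range (k - 1),
        (visit t (j + 1) - visit t j) * max 0 (min 1 (s - j)) : ℝ) : ℂ)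

/-- The point `v_j = (i t_j, x_j)` of an insertion. -/
def insertion {k : ℕ} (u : Fin k → Cyl) (j : Fin k) : ℂ × AddCircle (2 : ℝ) :=
  (Complex.I * ((u j).1 : ℂ), (u j).2)

/-- The point `(γ(s), y)` of the tube over the contour, for a parameter `p = (s, y)`. -/
def tubePoint {k : ℕ} (u : Fin k → Cyl) (p : Cyl) : ℂ × AddCircle (2 : ℝ) :=
  (contour (fun j => (u j).1) p.1, p.2)

/-- Time-ordered Green's function of two insertions: the larger label is the later one. -/
def greenExt {k : ℕ} (u : Fin k → Cyl) (i j : Fin k) : ℂ :=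
  if i < j then greenDiff (insertion u j) (insertion u i)
  else greenDiff (insertion u i) (insertion u j)

/-- Time-ordered Green's function of the insertion `j`, which is the marked visit of the contour
at the parameter `s = j`, and a screening point with parameter `p = (s, y)`. -/
def greenMixed {k : ℕ} (u : Fin k → Cyl) (j : Fin k) (p : Cyl) : ℂ :=
  if p.1 < ((j : ℕ) : ℝ) then greenDiff (insertion u j) (tubePoint u p)
  else greenDiff (tubePoint u p) (insertion u j)

/-- Time-ordered Green's function of two screening points. -/
def greenScreen {k : ℕ} (u : Fin k → Cyl) (p q : Cyl) : ℂ :=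
  if p.1 < q.1 then greenDiff (tubePoint u q) (tubePoint u p)
  else greenDiff (tubePoint u p) (tubePoint u q)

/-- The `w`-fold contour integral over the tube `M_γ^w`, where `M_γ = γ × [-1, 1]`. -/
def coulombIntegral (b : ℝ) (w : ℕ) {k : ℕ} (α : Fin k → ℂ) (u : Fin k → Cyl) : ℂ :=
  ∫ p : Fin w → Cyl,
    Complex.exp
        (-4 * (b : ℂ) * ∑ j, ∑ l, α j * greenMixed u j (p l)
          - 4 * (b : ℂ) ^ 2 * ∑ l, ∑ l' ∈ Finset.Ioi l, greenScreen u (p l) (p l'))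
      * ∏ l, deriv (contour fun j => (u j).1) (p l).1

/-- The Lorentzian correlator `C^L_{α_1, …, α_k}(u_1, …, u_k)` with `w` screening insertions, in
the sector `w = -b⁻¹ ∑ α_j ≥ 0`. -/
def lorentzCorrelator (b μ : ℝ) (w : ℕ) {k : ℕ} (α : Fin k → ℂ) (u : Fin k → Cyl) : ℂ :=
  (-(μ : ℂ)) ^ w / (w.factorial : ℂ)
    * Complex.exp (-4 * ∑ i, ∑ j ∈ Finset.Ioi i, α i * α j * greenExt u i j)
    * coulombIntegral b w α u

/-- The admissible integer charges, `|n| < 1 / (√2 b)`. -/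
abbrev Charge (b : ℝ) : Type := {n : ℤ // |(n : ℝ)| < 1 / (Real.sqrt 2 * b)}

/-- The correlator `C^L_{b n_1, …, b n_k}` of an integer charge tuple. It is identically zero when
the screening number `w = -∑ n_j` is negative. -/
def chargeCorrelator (b μ : ℝ) {k : ℕ} (n : Fin k → Charge b) (u : Fin k → Cyl) : ℂ :=
  if (-∑ j, (n j : ℤ)) < 0 then 0
  else lorentzCorrelator b μ (-∑ j, (n j : ℤ)).toNat (fun j => (b : ℂ) * ((n j : ℤ) : ℂ)) u

/-! ### Test functions -/

/-- The space `C_c^∞(M, ℂ)`. A function on `ℝ × ℝ / 2ℤ` is smooth when its pullback to the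
universal cover `ℝ × ℝ` is. -/
def TestFn : Submodule ℂ (Cyl → ℂ) where
  carrier := {f | ContDiff ℝ ∞ (fun p : ℝ × ℝ => f (p.1, (p.2 : AddCircle (2 : ℝ))))
    ∧ HasCompactSupport f}
  add_mem' := fun hf hg => ⟨hf.1.add hg.1, hf.2.add hg.2⟩
  zero_mem' := ⟨contDiff_const, HasCompactSupport.zero⟩
  smul_mem' := fun c _ hf => ⟨contDiff_const.smul hf.1, hf.2.smul_left (f := fun _ => c)⟩

/-- The complex conjugate `f̄` of a test function. -/
def conjFn (f : TestFn) : TestFn :=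
  ⟨fun u => (starRingEnd ℂ) (f.1 u),
    Complex.conjCLE.contDiff.comp f.2.1, f.2.2.comp_left (map_zero _)⟩

/-- The translate `(η_{a,θ} f)(u) = f (T_{-a,-θ} u)` of a test function, as a linear map. -/
def shiftFn (p : Cyl) : TestFn →ₗ[ℂ] TestFn where
  toFun f := ⟨fun u => f.1 (translate (-p) u), by
    constructor
    · obtain ⟨y, hy⟩ := QuotientAddGroup.mk_surjective p.2
      have h : (fun q : ℝ × ℝ => f.1 (translate (-p) (q.1, (q.2 : AddCircle (2 : ℝ)))))
          = (fun q : ℝ × ℝ => f.1 (q.1, (q.2 : AddCircle (2 : ℝ))))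
            ∘ fun q : ℝ × ℝ => (q.1 + -p.1, q.2 + -y) := by
        funext q
        simp only [translate, Function.comp, Prod.fst_neg, Prod.snd_neg, ← hy]
        rfl
      rw [h]
      exact f.2.1.comp (by fun_prop)
    · exact f.2.2.comp_homeomorph (Homeomorph.addRight (-p))⟩
  map_add' _ _ := rfl
  map_smul' _ _ := rfl

/-! ### The algebra of observables -/

/-- `𝒢`, the direct sum over the charges `n` of copies of `C_c^∞(M, ℂ)`. -/
abbrev Gen (b : ℝ) : Type := ⨁ _ : Charge b, TestFn

/-- The algebra `𝒜 = T(𝒢)`. -/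
abbrev Obs (b : ℝ) : Type := TensorAlgebra ℂ (Gen b)

/-- The basic smeared observable `𝒪_{f,n}`. -/
def smeared {b : ℝ} (f : TestFn) (n : Charge b) : Obs b :=
  TensorAlgebra.ι ℂ (DirectSum.lof ℂ (Charge b) (fun _ => TestFn) n f)

/-- Componentwise complex conjugation on `𝒢`. -/
def conjGen (b : ℝ) : Gen b →+ Gen b :=
  DirectSum.map fun _ => { toFun := conjFn
                           map_zero' := Subtype.ext (funext fun _ => map_zero _)
                           map_add' := fun _ _ => Subtype.ext (funext fun _ => map_add _ _ _) }

theorem conjGen_of {b : ℝ} (n : Charge b) (f : TestFn) :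
    conjGen b (DirectSum.lof ℂ (Charge b) (fun _ => TestFn) n f)
      = DirectSum.lof ℂ (Charge b) (fun _ => TestFn) n (conjFn f) :=
  DirectSum.map_of _ _ _

theorem conjGen_smul {b : ℝ} (c : ℂ) (g : Gen b) :
    conjGen b (c • g) = (starRingEnd ℂ) c • conjGen b g := by
  induction g using DirectSum.induction_on with
  | zero => simp
  | of n f =>
    have := conjGen_of (b := b) n (c • f)
    rw [map_smul] at this
    refine this.trans ?_
    have h : conjFn (c • f) = (starRingEnd ℂ) c • conjFn f :=
      Subtype.ext (funext fun _ => map_mul _ _ _)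
    rw [h, map_smul, ← conjGen_of]
    rfl
  | add x y hx hy => simp only [smul_add, map_add, hx, hy]

theorem conjGen_conjGen {b : ℝ} (g : Gen b) : conjGen b (conjGen b g) = g := by
  induction g using DirectSum.induction_on with
  | zero => simp
  | of n f =>
    have h : conjFn (conjFn f) = f := Subtype.ext (funext fun _ => Complex.conj_conj _)
    have := conjGen_of (b := b) n f
    have h2 := conjGen_of (b := b) n (conjFn f)
    rw [h, ← this] at h2
    exact h2
  | add x y hx hy => simp only [map_add, hx, hy]

/-- The opposite algebra of `𝒜` with the conjugate scalar multiplication: an algebra homomorphism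
into it is a conjugate-linear anti-multiplicative map into `𝒜`. -/
def ConjOp (b : ℝ) : Type := (Obs b)ᵐᵒᵖ

instance (b : ℝ) : Ring (ConjOp b) := inferInstanceAs (Ring (Obs b)ᵐᵒᵖ)

instance (b : ℝ) : Algebra ℂ (ConjOp b) :=
  ((algebraMap ℂ (Obs b)ᵐᵒᵖ).comp (starRingEnd ℂ)).toAlgebra'
    fun c x => Algebra.commutes ((starRingEnd ℂ) c) (show (Obs b)ᵐᵒᵖ from x)

/-- The anti-multiplicative conjugate-linear extension of conjugation on the generators. -/
def conjHom (b : ℝ) : Obs b →ₐ[ℂ] ConjOp b :=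
  TensorAlgebra.lift ℂ
    { toFun := fun g => (MulOpposite.op (TensorAlgebra.ι ℂ (conjGen b g)) : (Obs b)ᵐᵒᵖ)
      map_add' := fun x y => by simp only [map_add, MulOpposite.op_add]; rfl
      map_smul' := fun c x => by
        rw [conjGen_smul, map_smul]
        exact Algebra.smul_def ((starRingEnd ℂ) c)
          (MulOpposite.op (TensorAlgebra.ι ℂ (conjGen b x)) : (Obs b)ᵐᵒᵖ) }

/-- The involution `A ↦ A^*` of `𝒜`: conjugate-linear, anti-multiplicative, with
`𝒪_{f,n}^* = 𝒪_{f̄,n}`. -/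
def adj {b : ℝ} (A : Obs b) : Obs b := MulOpposite.unop (show (Obs b)ᵐᵒᵖ from conjHom b A)

theorem adj_add {b : ℝ} (x y : Obs b) : adj (x + y) = adj x + adj y :=
  congrArg MulOpposite.unop (map_add (conjHom b) x y)

theorem adj_mul {b : ℝ} (x y : Obs b) : adj (x * y) = adj y * adj x :=
  congrArg MulOpposite.unop (map_mul (conjHom b) x y)

theorem adj_algebraMap {b : ℝ} (c : ℂ) :
    adj (algebraMap ℂ (Obs b) c) = algebraMap ℂ (Obs b) ((starRingEnd ℂ) c) :=
  congrArg (fun z : ConjOp b => MulOpposite.unop (show (Obs b)ᵐᵒᵖ from z))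
    ((conjHom b).commutes c)

theorem adj_ι {b : ℝ} (g : Gen b) :
    adj (TensorAlgebra.ι ℂ g) = TensorAlgebra.ι ℂ (conjGen b g) :=
  congrArg (fun z : ConjOp b => MulOpposite.unop (show (Obs b)ᵐᵒᵖ from z))
    (TensorAlgebra.lift_ι_apply _ g)

theorem adj_adj {b : ℝ} (x : Obs b) : adj (adj x) = x := by
  induction x using TensorAlgebra.induction with
  | algebraMap r => rw [adj_algebraMap, adj_algebraMap, Complex.conj_conj]
  | ι g => rw [adj_ι, adj_ι, conjGen_conjGen]
  | mul x y hx hy => rw [adj_mul, adj_mul, hx, hy]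
  | add x y hx hy => rw [adj_add, adj_add, hx, hy]

instance (b : ℝ) : StarRing (Obs b) where
  star := adj
  star_involutive := adj_adj
  star_mul := adj_mul
  star_add := adj_add

instance (b : ℝ) : StarModule ℂ (Obs b) where
  star_smul c x := by
    change adj (c • x) = (starRingEnd ℂ) c • adj x
    rw [Algebra.smul_def, adj_mul, adj_algebraMap, Algebra.smul_def, Algebra.commutes]

theorem star_smeared {b : ℝ} (f : TestFn) (n : Charge b) :
    star (smeared f n) = smeared (conjFn f) n :=
  (adj_ι _).trans (congrArg _ (conjGen_of n f))

/-- The translation `η_{a,θ}` of `𝒜`: the linear and multiplicative extension of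
`𝒪_{f,n} ↦ 𝒪_{η_{a,θ} f, n}`. -/
def eta (b : ℝ) (p : Cyl) : Obs b →ₐ[ℂ] Obs b :=
  TensorAlgebra.lift ℂ (TensorAlgebra.ι ℂ ∘ₗ DirectSum.lmap fun _ => shiftFn p)

theorem eta_smeared (b : ℝ) (p : Cyl) (f : TestFn) (n : Charge b) :
    eta b p (smeared f n) = smeared (shiftFn p f) n := by
  simp [eta, smeared, DirectSum.lmap_lof]

/-! ### The vacuum functional -/

/-- The integrand of `⟨𝒪_{f_1,n_1} ⋯ 𝒪_{f_k,n_k}⟩`. -/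
def smearedIntegrand (b μ : ℝ) {k : ℕ} (n : Fin k → Charge b) (f : Fin k → TestFn)
    (u : Fin k → Cyl) : ℂ :=
  (∏ j, (f j).1 (u j)) * chargeCorrelator b μ n u

theorem smearedIntegrand_update_add (b μ : ℝ) {k : ℕ} (n : Fin k → Charge b)
    [DecidableEq (Fin k)] (f : Fin k → TestFn) (i : Fin k) (x y : TestFn) :
    smearedIntegrand b μ n (Function.update f i (x + y))
      = smearedIntegrand b μ n (Function.update f i x)
        + smearedIntegrand b μ n (Function.update f i y) := by
  funext u
  have h : ∀ z : TestFn, (fun j => (Function.update f i z j).1 (u j))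
      = Function.update (fun j => (f j).1 (u j)) i (z.1 (u i)) := by
    intro z; funext j
    by_cases hj : j = i
    · subst hj; simp
    · simp [hj]
  simp only [smearedIntegrand, Pi.add_apply, h, Finset.prod_update_of_mem (Finset.mem_univ i),
    Submodule.coe_add]
  ring

theorem smearedIntegrand_update_smul (b μ : ℝ) {k : ℕ} (n : Fin k → Charge b)
    [DecidableEq (Fin k)] (f : Fin k → TestFn) (i : Fin k) (c : ℂ) (x : TestFn) :
    smearedIntegrand b μ n (Function.update f i (c • x))
      = fun u => c * smearedIntegrand b μ n (Function.update f i x) u := by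
  funext u
  have h : ∀ z : TestFn, (fun j => (Function.update f i z j).1 (u j))
      = Function.update (fun j => (f j).1 (u j)) i (z.1 (u i)) := by
    intro z; funext j
    by_cases hj : j = i
    · subst hj; simp
    · simp [hj]
  simp only [smearedIntegrand, h, Finset.prod_update_of_mem (Finset.mem_univ i),
    Submodule.coe_smul, Pi.smul_apply, smul_eq_mul]
  ring

open Classical in
/-- The smeared vacuum expectations
`⟨𝒪_{f_1,n_1} ⋯ 𝒪_{f_k,n_k}⟩ = ∫_{M^k} ∏ f_j(u_j) C^L_{b n_1, …, b n_k}(u) du` of a charge tuple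
`n`, as a multilinear form in `f_1, …, f_k`. The integrals converge absolutely when
`0 < b < 1 / √2`; the form is only given a value (zero) by convention where they do not. -/
def smearedForm (b μ : ℝ) {k : ℕ} (n : Fin k → Charge b) :
    MultilinearMap ℂ (fun _ : Fin k => TestFn) ℂ :=
  if h : ∀ f : Fin k → TestFn, MeasureTheory.Integrable (smearedIntegrand b μ n f) then
    { toFun := fun f => ∫ u : Fin k → Cyl, smearedIntegrand b μ n f u
      map_update_add' := fun f i x y => by
        rw [smearedIntegrand_update_add]
        exact MeasureTheory.integral_add (h _) (h _)
      map_update_smul' := fun f i c x => by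
        rw [smearedIntegrand_update_smul]
        exact MeasureTheory.integral_const_mul c _ }
  else 0

/-- The vacuum functional `ω : 𝒜 → ℂ`, the linear functional with
`ω(𝒪_{f_1,n_1} ⋯ 𝒪_{f_k,n_k}) = ⟨𝒪_{f_1,n_1} ⋯ 𝒪_{f_k,n_k}⟩`. For the empty product this is the
integral over the one-point space `M⁰` of the correlator `1`. -/
def vacuum (b μ : ℝ) : Obs b →ₗ[ℂ] ℂ :=
  DirectSum.toModule ℂ ℕ ℂ
      (fun k => PiTensorProduct.lift
        (MultilinearMap.fromDirectSumEquiv (ι := Fin k) (κ := fun _ => Charge b)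
          (M := fun _ _ => TestFn) fun n => smearedForm b μ n))
    ∘ₗ (TensorAlgebra.toDirectSum (R := ℂ) (M := Gen b)).toLinearMap

theorem vacuum_monomial (b μ : ℝ) {k : ℕ} (n : Fin k → Charge b) (f : Fin k → TestFn) :
    vacuum b μ (List.ofFn fun j => smeared (f j) (n j)).prod = smearedForm b μ n f := by
  have h := TensorAlgebra.toDirectSum_tensorPower_tprod (R := ℂ) (M := Gen b) (n := k)
    (fun j => DirectSum.lof ℂ (Charge b) (fun _ => TestFn) (n j) (f j))
  rw [TensorAlgebra.tprod_apply] at h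
  simp only [vacuum, LinearMap.comp_apply, AlgHom.toLinearMap_apply, smeared]
  rw [h]
  refine Eq.trans (DirectSum.toModule_lof ℂ k _) ?_
  rw [PiTensorProduct.lift.tprod]
  exact MultilinearMap.fromDirectSumEquiv_lof (κ := fun _ : Fin k => Charge b)
    (M := fun _ _ => TestFn) (M' := ℂ) _ n f

/-! ### Local algebras -/

/-- The local algebra `𝒜(O)`, the unital `*`-subalgebra of `𝒜` generated by the `𝒪_{f,n}` with
`supp f ⊆ O`. -/
def localAlgebra (b : ℝ) (O : Set Cyl) : StarSubalgebra ℂ (Obs b) :=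
  StarAlgebra.adjoin ℂ
    {A | ∃ (f : TestFn) (n : Charge b), tsupport f.1 ⊆ O ∧ A = smeared f n}

/-- The restriction `ω_O` of the vacuum functional to the local algebra `𝒜(O)`. -/
def localVacuum (b μ : ℝ) (O : Set Cyl) : localAlgebra b O →ₗ[ℂ] ℂ :=
  vacuum b μ ∘ₗ (localAlgebra b O).subtype.toAlgHom.toLinearMap

/-- A linear functional `φ` on a unital `*`-algebra is normalized and Hermitian when `φ(1) = 1`
and `φ(A^*)` is the complex conjugate of `φ(A)` for all `A`. -/
def IsNormalizedHermitian {B : Type*} [Ring B] [StarRing B] [Algebra ℂ B] (φ : B →ₗ[ℂ] ℂ) : Prop :=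
  φ 1 = 1 ∧ ∀ A : B, φ (star A) = (starRingEnd ℂ) (φ A)

end TimelikeLiouville

end

noncomputable section
namespace TimelikeLiouville

/-! ### Translation invariance of the correlators -/

/-! Parts 2 and 5 come from two symmetries of the correlators; the rest is formal.

Translations. Adding a constant `a` to all times moves the contour rigidly by `i a`
(`contour_add_const`), and every Green's function sees only differences of points. A rotation of the
insertions is absorbed by rotating the screening points, which preserves their measure
(`coulombIntegral_translate`).

Hermiticity. Reversing the order of the insertions replaces the contour by its mirror image `-conj
γ`, traversed backwards (`contour_rev`). This map turns "later minus earlier" into its complex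
conjugate, and `g` commutes with conjugation for `Re τ ≥ 0` (`green_conj`) and is even in `x`. Since
`μ`, `b` and the charges are real, the correlator of the reversed tuple is the conjugate of the
original one (`chargeCorrelator_rev`), which matches the order-reversing, conjugating involution of
the algebra.

Both symmetries pass to the smeared forms by measure-preserving substitutions (`smearedForm_shift`,
`smearedForm_rev`) and then to `ω`, because monomials span the algebra (`obs_induction`). For the
local algebras it suffices to move the supports of the generators. -/

theorem green_neg (τ : ℂ) (x : AddCircle (2 : ℝ)) : green τ (-x) = green τ x := by
  simp only [green, neg_neg]
  ring

/-- Only the starting height records absolute time; the increments are unchanged. For `k = 0` the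
default value of `visit` does not shift, hence `hk`. -/
theorem contour_add_const {k : ℕ} (hk : 0 < k) (t : Fin k → ℝ) (a s : ℝ) :
    contour (fun j => t j + a) s = contour t s + Complex.I * a := by
  have h0 : visit (fun j => t j + a) 0 = visit t 0 + a := by simp [visit, hk]
  have h1 : ∀ j ∈ Finset.range (k - 1),
      (visit (fun j => t j + a) (j + 1) - visit (fun j => t j + a) j) * max 0 (min 1 (s - j))
        = (visit t (j + 1) - visit t j) * max 0 (min 1 (s - j)) := by
    intro j hj
    rw [Finset.mem_range] at hj
    have hj1 : j + 1 < k := by omega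
    have hj2 : j < k := by omega
    simp [visit, hj1, hj2]
  simp only [contour]
  rw [h0, Finset.sum_congr rfl h1]
  push_cast
  ring

theorem greenExt_translate {k : ℕ} (p : Cyl) (u : Fin k → Cyl) (i j : Fin k) :
    greenExt (fun j => translate p (u j)) i j = greenExt u i j := by
  simp only [greenExt, greenDiff, insertion, translate, add_sub_add_right_eq_sub,
    Complex.ofReal_add, mul_add]

theorem greenMixed_translate {k : ℕ} (p : Cyl) (u : Fin k → Cyl) (j : Fin k) (q : Cyl) :
    greenMixed (fun j => translate p (u j)) j (q.1, q.2 + p.2) = greenMixed u j q := by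
  simp only [greenMixed, greenDiff, insertion, tubePoint, translate, add_sub_add_right_eq_sub,
    Complex.ofReal_add, mul_add, contour_add_const (Fin.pos j)]

theorem greenScreen_translate {k : ℕ} (hk : 0 < k) (p : Cyl) (u : Fin k → Cyl) (q r : Cyl) :
    greenScreen (fun j => translate p (u j)) (q.1, q.2 + p.2) (r.1, r.2 + p.2)
      = greenScreen u q r := by
  simp only [greenScreen, greenDiff, tubePoint, translate, add_sub_add_right_eq_sub,
    contour_add_const hk]

theorem deriv_contour_translate {k : ℕ} (hk : 0 < k) (p : Cyl) (u : Fin k → Cyl) (s : ℝ) :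
    deriv (contour fun j => (translate p (u j)).1) s = deriv (contour fun j => (u j).1) s := by
  have h : (contour fun j => (translate p (u j)).1)
      = fun s => contour (fun j => (u j).1) s + Complex.I * p.1 :=
    funext fun s => contour_add_const hk _ _ _
  rw [h, deriv_add_const]

instance : (MeasureTheory.volume : MeasureTheory.Measure Cyl).IsAddLeftInvariant :=
  inferInstanceAs ((MeasureTheory.volume : MeasureTheory.Measure ℝ).prod
    (MeasureTheory.volume : MeasureTheory.Measure (AddCircle (2 : ℝ)))).IsAddLeftInvariant

theorem coulombIntegral_translate (b : ℝ) (w : ℕ) {k : ℕ} (hk : 0 < k) (α : Fin k → ℂ) (p : Cyl)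
    (u : Fin k → Cyl) :
    coulombIntegral b w α (fun j => translate p (u j)) = coulombIntegral b w α u := by
  simp only [coulombIntegral]
  -- Only the circle coordinates are shifted: a time translation moves the contour itself and leaves
  -- the parameter `s` alone.
  rw [← MeasureTheory.integral_add_right_eq_self _ (fun _ : Fin w => ((0, p.2) : Cyl))]
  have h : ∀ q : Cyl, q + (0, p.2) = (q.1, q.2 + p.2) := fun q => by ext <;> simp
  simp only [Pi.add_apply, h, greenMixed_translate, greenScreen_translate hk,
    deriv_contour_translate hk]

theorem chargeCorrelator_translate (b μ : ℝ) {k : ℕ} (n : Fin k → Charge b) (p : Cyl)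
    (u : Fin k → Cyl) :
    chargeCorrelator b μ n (fun j => translate p (u j)) = chargeCorrelator b μ n u := by
  rcases Nat.eq_zero_or_pos k with rfl | hk
  -- With no insertions there is only one configuration.
  · exact congrArg _ (Subsingleton.elim _ _)
  · simp only [chargeCorrelator, lorentzCorrelator, coulombIntegral_translate b _ hk,
      greenExt_translate]

/-! ### Reflection of the contour -/

theorem visit_rev {k : ℕ} (t : Fin k → ℝ) {j : ℕ} (hj : j < k) :
    visit (fun i => t i.rev) j = visit t (k - 1 - j) := by
  have h : k - 1 - j < k := by omega
  simp only [visit, hj, h, dif_pos]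
  congr 1
  ext
  simp only [Fin.val_rev]
  omega

theorem contour_re {k : ℕ} (t : Fin k → ℝ) (s : ℝ) :
    (contour t s).re = min s 0 + max (s - ((k : ℝ) - 1)) 0 := by
  simp only [contour, Complex.add_re, Complex.ofReal_re, Complex.re_mul_ofReal, Complex.I_re,
    zero_mul, add_zero]

theorem contour_im {k : ℕ} (t : Fin k → ℝ) (s : ℝ) :
    (contour t s).im = visit t 0 + ∑ j ∈ Finset.range (k - 1),
        (visit t (j + 1) - visit t j) * max 0 (min 1 (s - j)) := by
  simp only [contour, Complex.add_im, Complex.ofReal_im, Complex.im_mul_ofReal, Complex.I_im,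
    one_mul, zero_add]

/-- Puts every "later minus earlier" difference in `Re τ ≥ 0`, where `green_conj` applies. -/
theorem contour_re_mono {k : ℕ} (t : Fin k → ℝ) : Monotone fun s => (contour t s).re := by
  intro s s' h
  simp only [contour_re]
  gcongr

theorem clamp_reflect (x : ℝ) : max 0 (min 1 (1 - x)) = 1 - max 0 (min 1 x) := by
  rcases le_total x 0 with h | h
  · rw [min_eq_left (by linarith), min_eq_right (by linarith), max_eq_left h]; simp
  · rcases le_total x 1 with h' | h'
    · rw [min_eq_right (by linarith), min_eq_right h', max_eq_right (by linarith),
        max_eq_right h]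
    · rw [min_eq_right (by linarith), min_eq_left h', max_eq_left (by linarith)]; simp

/-- The parameter reversal `s ↦ k - 1 - s` exchanges the two horizontal legs, whence the sign of the
real part, and runs through the vertical segments backwards at the same heights. -/
theorem contour_rev {k : ℕ} (t : Fin k → ℝ) (s : ℝ) :
    contour (fun i => t i.rev) s = -(starRingEnd ℂ) (contour t ((k : ℝ) - 1 - s)) := by
  apply Complex.ext
  · simp only [contour_re, Complex.neg_re, Complex.conj_re]
    have h1 : min ((k : ℝ) - 1 - s) 0 = -max (s - ((k : ℝ) - 1)) 0 := by
      rw [← neg_zero, ← neg_sub s, min_neg_neg]; simp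
    have h2 : max ((k : ℝ) - 1 - s - ((k : ℝ) - 1)) 0 = -min s 0 := by
      rw [show (k : ℝ) - 1 - s - ((k : ℝ) - 1) = -s by ring]
      nth_rewrite 1 [← neg_zero]
      rw [max_neg_neg]
    rw [h1, h2]
    ring
  · simp only [contour_im, Complex.neg_im, Complex.conj_im, neg_neg]
    rcases Nat.eq_zero_or_pos k with rfl | hk
    · simp [visit]
    have hk' : ((k - 1 : ℕ) : ℝ) = (k : ℝ) - 1 := by simp [Nat.cast_sub hk]
    rw [visit_rev t hk, Nat.sub_zero]
    rw [← Finset.sum_range_reflect]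
    -- Reversing a segment changes the sign of its increment and replaces its clamp `c` by `1 - c`.
    -- The leftover increments telescope to the difference of the two end heights.
    have h : ∀ j ∈ Finset.range (k - 1),
        (visit (fun i => t i.rev) (k - 1 - 1 - j + 1) - visit (fun i => t i.rev) (k - 1 - 1 - j))
            * max 0 (min 1 (s - ((k - 1 - 1 - j : ℕ) : ℝ)))
          = (visit t (j + 1) - visit t j) * max 0 (min 1 ((k : ℝ) - 1 - s - j))
            - (visit t (j + 1) - visit t j) := by
      intro j hj
      rw [Finset.mem_range] at hj
      rw [visit_rev t (by omega), visit_rev t (by omega),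
        show k - 1 - (k - 1 - 1 - j + 1) = j by omega, show k - 1 - (k - 1 - 1 - j) = j + 1 by omega]
      have hc : ((k - 1 - 1 - j : ℕ) : ℝ) = (k : ℝ) - 1 - 1 - j := by
        rw [show k - 1 - 1 - j = k - (1 + 1 + j) by omega, Nat.cast_sub (by omega)]
        push_cast; ring
      rw [hc, show s - ((k : ℝ) - 1 - 1 - j) = 1 - ((k : ℝ) - 1 - s - j) by ring, clamp_reflect]
      ring
    rw [Finset.sum_congr rfl h, Finset.sum_sub_distrib, Finset.sum_range_sub (visit t)]
    ring

/-- At `s = j` the first `j` clamps equal `1` and the others `0`, so the increments telescope.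
Needed where a screening point coincides in parameter with a marked visit. -/
theorem contour_natCast {k : ℕ} (t : Fin k → ℝ) (j : Fin k) :
    contour t ((j : ℕ) : ℝ) = Complex.I * (t j : ℂ) := by
  have hj : ((j : ℕ) : ℝ) ≤ (k : ℝ) - 1 := by
    have : ((j : ℕ) : ℝ) + 1 ≤ k := by exact_mod_cast j.2
    linarith
  apply Complex.ext
  · rw [contour_re, min_eq_right (Nat.cast_nonneg _), max_eq_right (by linarith)]
    simp
  · rw [contour_im]
    have h : ∑ i ∈ Finset.range (k - 1),
        (visit t (i + 1) - visit t i) * max 0 (min 1 (((j : ℕ) : ℝ) - i))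
          = ∑ i ∈ Finset.range j, (visit t (i + 1) - visit t i) := by
      have hs : Finset.range j ⊆ Finset.range (k - 1) :=
        Finset.range_subset_range.2 (by omega)
      rw [← Finset.sum_subset hs]
      · refine Finset.sum_congr rfl fun i hi => ?_
        rw [Finset.mem_range] at hi
        have : (i : ℝ) + 1 ≤ (j : ℕ) := by exact_mod_cast hi
        rw [min_eq_left (by linarith), max_eq_right zero_le_one, mul_one]
      · intro i _ hi
        rw [Finset.mem_range, not_lt] at hi
        have : ((j : ℕ) : ℝ) ≤ i := by exact_mod_cast hi
        rw [max_eq_left ((min_le_right _ _).trans (by linarith)), mul_zero]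
    rw [h, Finset.sum_range_sub (visit t)]
    simp [visit]

/-- The sign of `-conj` cancels that of `s ↦ k - 1 - s`. The identity holds at corners too, where
`deriv` takes its default value on both sides. -/
theorem deriv_contour_rev {k : ℕ} (t : Fin k → ℝ) (s : ℝ) :
    deriv (contour fun i => t i.rev) ((k : ℝ) - 1 - s)
      = (starRingEnd ℂ) (deriv (contour t) s) := by
  have h : (contour fun i => t i.rev)
      = fun s => -star (contour t ((k : ℝ) - 1 - s)) := funext fun s => contour_rev t s
  rw [h, deriv.fun_neg, deriv.star, deriv_comp_const_sub, sub_sub_cancel, star_neg, neg_neg]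
  rfl

/-! ### Complex conjugation of the Green's functions -/

/-- For `‖z‖ ≤ 1` the number `1 - z` has nonnegative real part, so it stays off the branch cut; `z =
1` causes no exception because `arg 0 = 0`. -/
theorem log_one_sub_conj {z : ℂ} (hz : ‖z‖ ≤ 1) :
    Complex.log (1 - (starRingEnd ℂ) z) = (starRingEnd ℂ) (Complex.log (1 - z)) := by
  rw [← Complex.log_conj]
  · simp
  · intro h
    rw [Complex.arg_eq_pi_iff] at h
    have := (Complex.re_le_norm z).trans hz
    have h1 := h.1
    simp only [Complex.sub_re, Complex.one_re] at h1
    linarith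

theorem green_conj {τ : ℂ} (hτ : 0 ≤ τ.re) (x : AddCircle (2 : ℝ)) :
    green ((starRingEnd ℂ) τ) x = (starRingEnd ℂ) (green τ x) := by
  have hn : ∀ y : AddCircle (2 : ℝ),
      ‖Complex.exp (-(Real.pi * τ)) * (AddCircle.toCircle y : ℂ)‖ ≤ 1 := by
    intro y
    rw [norm_mul, Circle.norm_coe, mul_one, Complex.norm_exp, Real.exp_le_one_iff]
    simp only [Complex.neg_re, Complex.re_ofReal_mul]
    have := mul_nonneg Real.pi_pos.le hτ
    linarith
  -- Conjugation inverts the phase and so exchanges the two logarithms of `green`.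
  have hc : ∀ y : AddCircle (2 : ℝ),
      Complex.exp (-(Real.pi * (starRingEnd ℂ) τ)) * (AddCircle.toCircle y : ℂ)
        = (starRingEnd ℂ) (Complex.exp (-(Real.pi * τ)) * (AddCircle.toCircle (-y) : ℂ)) := by
    intro y
    rw [map_mul, ← Complex.exp_conj, AddCircle.toCircle_neg, ← Circle.coe_inv_eq_conj, inv_inv]
    simp
  simp only [green, map_sub, map_neg, map_div₀, map_mul, Complex.conj_ofReal]
  rw [hc, hc, log_one_sub_conj (hn _), log_one_sub_conj (hn _), neg_neg]
  simp only [map_ofNat]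
  ring

/-- Since `-conj z' - (-conj z) = conj (z - z')`, reversing the order keeps `Re τ ≥ 0`; the sign
change of the circle difference is harmless by evenness. -/
theorem greenDiff_reflect {z z' : ℂ × AddCircle (2 : ℝ)} (h : z'.1.re ≤ z.1.re) :
    greenDiff (-(starRingEnd ℂ) z'.1, z'.2) (-(starRingEnd ℂ) z.1, z.2)
      = (starRingEnd ℂ) (greenDiff z z') := by
  simp only [greenDiff]
  rw [← green_conj (by simpa using h), ← green_neg, map_sub]
  congr 1
  · ring
  · abel

theorem insertion_rev {k : ℕ} (u : Fin k → Cyl) (j : Fin k) :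
    insertion (fun i => u i.rev) j
      = (-(starRingEnd ℂ) (insertion u j.rev).1, (insertion u j.rev).2) := by
  simp [insertion]

theorem tubePoint_rev {k : ℕ} (u : Fin k → Cyl) (p : Cyl) :
    tubePoint (fun i => u i.rev) ((k : ℝ) - 1 - p.1, p.2)
      = (-(starRingEnd ℂ) (tubePoint u p).1, (tubePoint u p).2) := by
  simp only [tubePoint]
  rw [contour_rev (fun i => (u i).1), sub_sub_cancel]

/-- Settles ties: at equal parameters the strict comparison takes the same `else` branch before and
after reflection, so the order of the arguments must not matter. -/
theorem greenDiff_of_eq {z z' : ℂ × AddCircle (2 : ℝ)} (h : z.1 = z'.1) :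
    greenDiff z z' = greenDiff z' z := by
  rw [greenDiff, greenDiff, h, ← green_neg, neg_sub]

theorem greenExt_rev {k : ℕ} (u : Fin k → Cyl) (i j : Fin k) :
    greenExt (fun i => u i.rev) i j = (starRingEnd ℂ) (greenExt u j.rev i.rev) := by
  have hre : ∀ i j : Fin k, (insertion u i).1.re ≤ (insertion u j).1.re := by
    intro i j; simp [insertion]
  simp only [greenExt, Fin.rev_lt_rev, insertion_rev]
  split_ifs with hij
  · rw [greenDiff_reflect (hre _ _)]
  · rw [greenDiff_reflect (hre _ _)]

theorem cast_rev {k : ℕ} (j : Fin k) : (((j.rev : Fin k) : ℕ) : ℝ) = (k : ℝ) - 1 - (j : ℕ) := by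
  rw [Fin.val_rev, Nat.cast_sub (by omega)]
  push_cast; ring

theorem insertion_fst_eq {k : ℕ} (u : Fin k → Cyl) (j : Fin k) :
    (insertion u j).1 = contour (fun i => (u i).1) ((j : ℕ) : ℝ) :=
  (contour_natCast (fun i => (u i).1) j).symm

theorem greenMixed_rev {k : ℕ} (u : Fin k → Cyl) (j : Fin k) (p : Cyl) :
    greenMixed (fun i => u i.rev) j ((k : ℝ) - 1 - p.1, p.2)
      = (starRingEnd ℂ) (greenMixed u j.rev p) := by
  simp only [greenMixed, insertion_rev, tubePoint_rev, cast_rev]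
  rcases lt_trichotomy p.1 ((k : ℝ) - 1 - (j : ℕ)) with h | h | h
  · have hre : (tubePoint u p).1.re ≤ (insertion u j.rev).1.re := by
      rw [insertion_fst_eq, cast_rev]; exact contour_re_mono _ h.le
    rw [if_neg (by linarith), if_pos h, greenDiff_reflect hre]
  · have heq : (tubePoint u p).1 = (insertion u j.rev).1 := by
      rw [insertion_fst_eq, cast_rev, ← h]; rfl
    rw [if_neg (by linarith), if_neg (by linarith),
      greenDiff_reflect (congrArg Complex.re heq).le, greenDiff_of_eq heq]
  · have hre : (insertion u j.rev).1.re ≤ (tubePoint u p).1.re := by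
      rw [insertion_fst_eq, cast_rev]; exact contour_re_mono _ h.le
    rw [if_pos (by linarith), if_neg (by linarith), greenDiff_reflect hre]

theorem greenScreen_rev {k : ℕ} (u : Fin k → Cyl) (p q : Cyl) :
    greenScreen (fun i => u i.rev) ((k : ℝ) - 1 - p.1, p.2) ((k : ℝ) - 1 - q.1, q.2)
      = (starRingEnd ℂ) (greenScreen u p q) := by
  simp only [greenScreen, tubePoint_rev]
  rcases lt_trichotomy p.1 q.1 with h | h | h
  · have hre : (tubePoint u p).1.re ≤ (tubePoint u q).1.re := contour_re_mono _ h.le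
    rw [if_neg (by linarith), if_pos h, greenDiff_reflect hre]
  · have heq : (tubePoint u p).1 = (tubePoint u q).1 := by simp only [tubePoint, h]
    rw [if_neg (by linarith), if_neg (by linarith), greenDiff_of_eq heq,
      greenDiff_reflect (congrArg Complex.re heq).le]
  · have hre : (tubePoint u q).1.re ≤ (tubePoint u p).1.re := contour_re_mono _ h.le
    rw [if_pos (by linarith), if_neg (by linarith), greenDiff_reflect hre]

/-! ### Reflection of the correlators -/

/-- `(i, j) ↦ (j.rev, i.rev)` permutes the pairs `i < j`. -/
theorem sum_pairs_rev {k : ℕ} (F : Fin k → Fin k → ℂ) :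
    ∑ i : Fin k, ∑ j ∈ Finset.Ioi i, F j.rev i.rev = ∑ i, ∑ j ∈ Finset.Ioi i, F i j := by
  have h : ∀ i : Fin k, Finset.Ioi i = Finset.univ.filter (i < ·) := fun i => by ext; simp
  simp only [h, Finset.sum_filter]
  rw [Finset.sum_comm, ← Equiv.sum_comp Fin.revPerm]
  refine Finset.sum_congr rfl fun i _ => ?_
  rw [← Equiv.sum_comp Fin.revPerm]
  simp only [Fin.revPerm_apply, Fin.rev_lt_rev, Fin.rev_rev]

/-- The reflection `(s, y) ↦ (c - s, y)` of the parameters of a tube. -/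
def reflectTube (c : ℝ) : Cyl ≃ᵐ Cyl :=
  MeasurableEquiv.ofInvolutive (fun p => (c - p.1, p.2)) (fun p => by simp) (by fun_prop)

theorem measurePreserving_reflectTube (c : ℝ) :
    MeasureTheory.MeasurePreserving (reflectTube c) MeasureTheory.volume MeasureTheory.volume :=
  (MeasureTheory.Measure.measurePreserving_sub_left MeasureTheory.volume c).prod
    (MeasureTheory.MeasurePreserving.id _)

theorem measurePreserving_reflectTubes (c : ℝ) (w : ℕ) :
    MeasureTheory.MeasurePreserving
      (MeasurableEquiv.piCongrRight fun _ : Fin w => reflectTube c)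
      MeasureTheory.volume MeasureTheory.volume :=
  MeasureTheory.volume_preserving_pi fun _ => measurePreserving_reflectTube c

theorem coulombIntegral_rev (b : ℝ) (w : ℕ) {k : ℕ} (α : Fin k → ℂ) (u : Fin k → Cyl) :
    coulombIntegral b w (fun i => (starRingEnd ℂ) (α i.rev)) (fun i => u i.rev)
      = (starRingEnd ℂ) (coulombIntegral b w α u) := by
  simp only [coulombIntegral]
  rw [← integral_conj,
    -- Each screening parameter is reflected by `s ↦ k - 1 - s`; the integrands then agree up to
    -- relabelling the insertions.
    ← (measurePreserving_reflectTubes ((k : ℝ) - 1) w).integral_comp']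
  refine congrArg _ (funext fun p => ?_)
  have hp : ∀ l, (MeasurableEquiv.piCongrRight fun _ : Fin w => reflectTube ((k : ℝ) - 1)) p l
      = ((k : ℝ) - 1 - (p l).1, (p l).2) := fun _ => rfl
  simp only [hp, greenMixed_rev, greenScreen_rev, deriv_contour_rev (fun i => (u i).1), map_mul,
    map_prod, ← Complex.exp_conj, map_sub, map_sum, map_neg, map_pow, Complex.conj_ofReal,
    map_ofNat]
  rw [← Equiv.sum_comp Fin.revPerm
    (fun j => ∑ l, (starRingEnd ℂ) (α j) * (starRingEnd ℂ) (greenMixed u j (p l)))]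
  rfl

theorem lorentzCorrelator_rev (b μ : ℝ) (w : ℕ) {k : ℕ} (α : Fin k → ℂ) (u : Fin k → Cyl) :
    lorentzCorrelator b μ w (fun i => (starRingEnd ℂ) (α i.rev)) (fun i => u i.rev)
      = (starRingEnd ℂ) (lorentzCorrelator b μ w α u) := by
  have h := sum_pairs_rev fun i j => (starRingEnd ℂ) (α i * α j * greenExt u i j)
  simp only [lorentzCorrelator, coulombIntegral_rev, map_mul, ← Complex.exp_conj, map_div₀,
    map_pow, map_neg, Complex.conj_ofReal, map_natCast, map_ofNat, map_sum, greenExt_rev] at h ⊢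
  rw [← h]
  have hc : ∀ i j : Fin k, (starRingEnd ℂ) (α i.rev) * (starRingEnd ℂ) (α j.rev)
        * (starRingEnd ℂ) (greenExt u j.rev i.rev)
      = (starRingEnd ℂ) (α j.rev) * (starRingEnd ℂ) (α i.rev)
        * (starRingEnd ℂ) (greenExt u j.rev i.rev) := fun i j => by ring
  rw [Finset.sum_congr rfl fun i _ => Finset.sum_congr rfl fun j _ => hc i j]

theorem chargeCorrelator_rev (b μ : ℝ) {k : ℕ} (n : Fin k → Charge b) (u : Fin k → Cyl) :
    chargeCorrelator b μ (fun i => n i.rev) (fun i => u i.rev)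
      = (starRingEnd ℂ) (chargeCorrelator b μ n u) := by
  have hs : ∑ j : Fin k, (n j.rev : ℤ) = ∑ j, (n j : ℤ) :=
    Equiv.sum_comp Fin.revPerm fun j => (n j : ℤ)
  simp only [chargeCorrelator, hs]
  split_ifs
  · simp
  · rw [← lorentzCorrelator_rev]
    simp

/-! ### Symmetries of the smeared correlators -/

theorem shiftFn_apply (p : Cyl) (f : TestFn) (u : Cyl) :
    (shiftFn p f).1 u = f.1 (translate (-p) u) := rfl

theorem conjFn_conjFn (f : TestFn) : conjFn (conjFn f) = f :=
  Subtype.ext (funext fun _ => Complex.conj_conj _)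

theorem translate_neg_translate (p u : Cyl) : translate (-p) (translate p u) = u := by
  simp [translate]

theorem translate_translate_neg (p u : Cyl) : translate p (translate (-p) u) = u := by
  simp [translate]

theorem shiftFn_zero : shiftFn 0 = LinearMap.id :=
  LinearMap.ext fun f => Subtype.ext (funext fun u => by simp [shiftFn_apply, translate])

theorem shiftFn_add (p q : Cyl) : shiftFn (p + q) = shiftFn p ∘ₗ shiftFn q :=
  LinearMap.ext fun f => Subtype.ext (funext fun u => by
    simp only [LinearMap.comp_apply, shiftFn_apply, translate, Prod.fst_neg, Prod.snd_neg,
      Prod.fst_add, Prod.snd_add, neg_add, add_assoc])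

theorem smearedIntegrand_shift (b μ : ℝ) {k : ℕ} (n : Fin k → Charge b) (f : Fin k → TestFn)
    (p : Cyl) :
    smearedIntegrand b μ n (fun j => shiftFn p (f j))
      = fun u => smearedIntegrand b μ n f (u + fun _ => -p) := by
  funext u
  have h := chargeCorrelator_translate b μ n (-p) u
  simp only [smearedIntegrand, shiftFn_apply, ← h]
  rfl

theorem smearedForm_shift (b μ : ℝ) {k : ℕ} (n : Fin k → Charge b) (f : Fin k → TestFn)
    (p : Cyl) : smearedForm b μ n (fun j => shiftFn p (f j)) = smearedForm b μ n f := by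
  by_cases h : ∀ f : Fin k → TestFn, MeasureTheory.Integrable (smearedIntegrand b μ n f)
  · simp only [smearedForm, dif_pos h, MultilinearMap.coe_mk, smearedIntegrand_shift]
    exact MeasureTheory.integral_add_right_eq_self _ _
  · simp only [smearedForm, dif_neg h, zero_apply]

/-- The reversal of the order of a tuple of points. -/
def reverseTuple (k : ℕ) : (Fin k → Cyl) ≃ᵐ (Fin k → Cyl) :=
  MeasurableEquiv.ofInvolutive (fun u i => u i.rev) (fun u => by simp) (by fun_prop)

theorem measurePreserving_reverseTuple (k : ℕ) :
    MeasureTheory.MeasurePreserving (reverseTuple k) MeasureTheory.volume MeasureTheory.volume := by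
  convert MeasureTheory.volume_measurePreserving_piCongrLeft (fun _ : Fin k => Cyl) Fin.revPerm
    using 1
  funext u i
  obtain ⟨j, rfl⟩ := Fin.revPerm.surjective i
  rw [MeasurableEquiv.piCongrLeft_apply_apply]
  exact congrArg u (Fin.rev_rev j)

theorem smearedIntegrand_rev (b μ : ℝ) {k : ℕ} (n : Fin k → Charge b) (f : Fin k → TestFn) :
    smearedIntegrand b μ (fun i => n i.rev) (fun i => conjFn (f i.rev))
      = fun u => (starRingEnd ℂ) (smearedIntegrand b μ n f (reverseTuple k u)) := by
  funext u
  have hu : ∀ i, u i = reverseTuple k u i.rev := fun i => congrArg u (Fin.rev_rev i).symm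
  have h := chargeCorrelator_rev b μ n (reverseTuple k u)
  simp only [← hu] at h
  have hprod : ∏ j : Fin k, (f j.rev).1 (u j) = ∏ j, (f j).1 (reverseTuple k u j) := by
    rw [← Equiv.prod_comp Fin.revPerm]
    exact Finset.prod_congr rfl fun j _ => by
      rw [hu (Fin.revPerm j)]; simp only [Fin.revPerm_apply, Fin.rev_rev]
  simp only [smearedIntegrand, map_mul, ← h, ← hprod, map_prod]
  rfl

/-- Ensures that `smearedForm` takes the same branch for a charge tuple and its reversal. -/
theorem integrable_smearedIntegrand_rev {b μ : ℝ} {k : ℕ} {n : Fin k → Charge b}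
    (h : ∀ f : Fin k → TestFn, MeasureTheory.Integrable (smearedIntegrand b μ n f))
    (f : Fin k → TestFn) :
    MeasureTheory.Integrable (smearedIntegrand b μ (fun i => n i.rev) f) := by
  -- Conjugate reversal is an involution, so every tuple of test functions arises from one paired
  -- with `n`.
  have hf : f = fun i => conjFn ((fun j => conjFn (f j.rev)) i.rev) := by
    simp only [Fin.rev_rev, conjFn_conjFn]
  have hi := smearedIntegrand_rev b μ n fun j => conjFn (f j.rev)
  rw [← hf] at hi
  rw [hi]
  exact Complex.conjCLE.toContinuousLinearMap.integrable_comp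
    ((measurePreserving_reverseTuple k).integrable_comp_of_integrable (h _))

theorem smearedForm_rev (b μ : ℝ) {k : ℕ} (n : Fin k → Charge b) (f : Fin k → TestFn) :
    smearedForm b μ (fun i => n i.rev) (fun i => conjFn (f i.rev))
      = (starRingEnd ℂ) (smearedForm b μ n f) := by
  by_cases h : ∀ f : Fin k → TestFn, MeasureTheory.Integrable (smearedIntegrand b μ n f)
  · simp only [smearedForm, dif_pos h, dif_pos (integrable_smearedIntegrand_rev h),
      MultilinearMap.coe_mk, smearedIntegrand_rev]
    rw [integral_conj, (measurePreserving_reverseTuple k).integral_comp']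
  · have h' : ¬ ∀ f : Fin k → TestFn,
        MeasureTheory.Integrable (smearedIntegrand b μ (fun i => n i.rev) f) := fun hr => by
      have := integrable_smearedIntegrand_rev hr
      simp only [Fin.rev_rev] at this
      exact h this
    simp only [smearedForm, dif_neg h, dif_neg h', zero_apply, map_zero]

theorem volume_real_univ_empty :
    (MeasureTheory.volume : MeasureTheory.Measure (Fin 0 → Cyl)).real Set.univ = 1 := by
  rw [MeasureTheory.Measure.volume_pi_eq_dirac]
  simp

theorem smearedForm_empty (b μ : ℝ) (n : Fin 0 → Charge b) (f : Fin 0 → TestFn) :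
    smearedForm b μ n f = 1 := by
  have h1 : ∀ f, smearedIntegrand b μ n f = fun _ => 1 := by
    intro f
    funext u
    have hw : (-∑ j, (n j : ℤ)).toNat = 0 := by simp
    simp only [smearedIntegrand, chargeCorrelator, lorentzCorrelator, hw]
    simp [coulombIntegral, volume_real_univ_empty]
  simp [smearedForm, h1, volume_real_univ_empty]

/-! ### The algebra, its translations and the vacuum functional -/

theorem ι_mem_span_smeared {b : ℝ} (g : Gen b) :
    TensorAlgebra.ι ℂ g ∈ Submodule.span ℂ
      {A : Obs b | ∃ (f : TestFn) (n : Charge b), A = smeared f n} := by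
  induction g using DirectSum.induction_on with
  | zero => simp
  | of n f => exact Submodule.subset_span ⟨f, n, rfl⟩
  | add x y hx hy => rw [map_add]; exact add_mem hx hy

theorem adjoin_smeared (b : ℝ) :
    Algebra.adjoin ℂ {A : Obs b | ∃ (f : TestFn) (n : Charge b), A = smeared f n} = ⊤ := by
  rw [eq_top_iff, ← TensorAlgebra.adjoin_range_ι]
  refine Algebra.adjoin_le ?_
  rintro _ ⟨g, rfl⟩
  exact Algebra.span_le_adjoin ℂ _ (ι_mem_span_smeared g)

/-- The smeared generators generate the algebra, and an adjoined algebra is the linear span of the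
products of its generators; `k = 0` supplies the unit. -/
theorem obs_induction {b : ℝ} {P : Obs b → Prop}
    (monomial : ∀ (k : ℕ) (n : Fin k → Charge b) (f : Fin k → TestFn),
      P (List.ofFn fun j => smeared (f j) (n j)).prod)
    (add : ∀ x y, P x → P y → P (x + y)) (smul : ∀ (c : ℂ) (x), P x → P (c • x)) (A : Obs b) :
    P A := by
  have hA : A ∈ Subalgebra.toSubmodule (Algebra.adjoin ℂ
      {A : Obs b | ∃ (f : TestFn) (n : Charge b), A = smeared f n}) := by
    rw [adjoin_smeared]; trivial
  rw [Algebra.adjoin_eq_span] at hA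
  induction hA using Submodule.span_induction with
  | mem x hx =>
    obtain ⟨l, hl, rfl⟩ := Submonoid.exists_list_of_mem_closure hx
    have h : ∀ j : Fin l.length, ∃ (f : TestFn) (n : Charge b), l.get j = smeared f n :=
      fun j => hl _ (List.get_mem l j)
    choose f n hfn using h
    have := monomial l.length n f
    simp only [← hfn] at this
    rwa [List.ofFn_get] at this
  | zero => simpa using smul 0 _ (monomial 0 Fin.elim0 Fin.elim0)
  | add x y _ _ hx hy => exact add x y hx hy
  | smul c x _ hx => exact smul c x hx

theorem algHom_ext_smeared {b : ℝ} {φ ψ : Obs b →ₐ[ℂ] Obs b}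
    (h : ∀ f n, φ (smeared f n) = ψ (smeared f n)) : φ = ψ :=
  AlgHom.ext_of_adjoin_eq_top (adjoin_smeared b) (by rintro _ ⟨f, n, rfl⟩; exact h f n)

theorem eta_zero (b : ℝ) : eta b 0 = AlgHom.id ℂ (Obs b) :=
  algHom_ext_smeared fun f n => by simp [eta_smeared, shiftFn_zero]

theorem eta_add (b : ℝ) (p q : Cyl) : eta b (p + q) = (eta b p).comp (eta b q) :=
  algHom_ext_smeared fun f n => by simp [eta_smeared, shiftFn_add]

theorem eta_eta_neg (b : ℝ) (p : Cyl) (A : Obs b) : eta b p (eta b (-p) A) = A := by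
  rw [← AlgHom.comp_apply, ← eta_add, add_neg_cancel, eta_zero, AlgHom.id_apply]

theorem eta_neg_eta (b : ℝ) (p : Cyl) (A : Obs b) : eta b (-p) (eta b p A) = A := by
  rw [← AlgHom.comp_apply, ← eta_add, neg_add_cancel, eta_zero, AlgHom.id_apply]

theorem star_monomial {b : ℝ} {k : ℕ} (n : Fin k → Charge b) (f : Fin k → TestFn) :
    star (List.ofFn fun j => smeared (f j) (n j)).prod
      = (List.ofFn fun j => smeared (conjFn (f j.rev)) (n j.rev)).prod := by
  have h : ∀ l : List (Obs b), star l.prod = (l.map star).reverse.prod := by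
    intro l
    induction l with
    | nil => simp
    | cons a l ih => simp [ih]
  rw [h, List.map_ofFn]
  congr 1
  apply List.ext_get (by simp)
  intro i _ _
  simp only [List.get_eq_getElem, List.getElem_reverse, List.getElem_ofFn, List.length_ofFn,
    Function.comp_apply, star_smeared, Fin.rev, Nat.sub_sub, Nat.add_comm 1]

theorem eta_monomial {b : ℝ} {k : ℕ} (p : Cyl) (n : Fin k → Charge b) (f : Fin k → TestFn) :
    eta b p (List.ofFn fun j => smeared (f j) (n j)).prod
      = (List.ofFn fun j => smeared (shiftFn p (f j)) (n j)).prod := by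
  rw [map_list_prod, List.map_ofFn]
  simp only [Function.comp_def, eta_smeared]

theorem eta_star (b : ℝ) (p : Cyl) (A : Obs b) : eta b p (star A) = star (eta b p A) := by
  induction A using obs_induction with
  | monomial k n f =>
    rw [star_monomial, eta_monomial, eta_monomial, star_monomial]
    rfl
  | add x y hx hy => simp only [star_add, map_add, hx, hy]
  | smul c x hx => simp only [star_smul, map_smul, hx]

theorem vacuum_eta (b μ : ℝ) (p : Cyl) (A : Obs b) :
    vacuum b μ (eta b p A) = vacuum b μ A := by
  induction A using obs_induction with
  | monomial k n f => rw [eta_monomial, vacuum_monomial, vacuum_monomial, smearedForm_shift]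
  | add x y hx hy => simp only [map_add, hx, hy]
  | smul c x hx => simp only [map_smul, hx]

theorem vacuum_one (b μ : ℝ) : vacuum b μ 1 = 1 := by
  have h := vacuum_monomial b μ (k := 0) Fin.elim0 Fin.elim0
  rwa [smearedForm_empty, List.ofFn_zero, List.prod_nil] at h

theorem vacuum_star (b μ : ℝ) (A : Obs b) :
    vacuum b μ (star A) = (starRingEnd ℂ) (vacuum b μ A) := by
  induction A using obs_induction with
  | monomial k n f => rw [star_monomial, vacuum_monomial, vacuum_monomial, smearedForm_rev]
  | add x y hx hy => simp only [star_add, map_add, hx, hy]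
  | smul c x hx =>
    simp only [star_smul, map_smul, hx, smul_eq_mul, map_mul]
    rfl

/-! ### Local algebras -/

theorem localAlgebra_mono (b : ℝ) {O₁ O₂ : Set Cyl} (h : O₁ ⊆ O₂) :
    localAlgebra b O₁ ≤ localAlgebra b O₂ :=
  StarAlgebra.adjoin_mono fun _ ⟨f, n, hf, hA⟩ => ⟨f, n, hf.trans h, hA⟩

theorem tsupport_shiftFn (p : Cyl) (f : TestFn) :
    tsupport (shiftFn p f).1 = translate (-p) ⁻¹' tsupport f.1 :=
  tsupport_comp_eq_preimage f.1 (Homeomorph.addRight (-p))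

theorem eta_mem_localAlgebra {b : ℝ} (p : Cyl) {O : Set Cyl} {A : Obs b}
    (hA : A ∈ localAlgebra b O) : eta b p A ∈ localAlgebra b (translate p '' O) := by
  -- As a `*`-homomorphism, `eta b p` pulls `*`-subalgebras back to `*`-subalgebras, so only
  -- generators need checking.
  let φ : Obs b →⋆ₐ[ℂ] Obs b := { eta b p with map_star' := eta_star b p }
  have h : localAlgebra b O ≤ (localAlgebra b (translate p '' O)).comap φ := by
    refine StarAlgebra.adjoin_le ?_
    rintro _ ⟨f, n, hf, rfl⟩
    refine StarAlgebra.subset_adjoin ℂ _ ⟨shiftFn p f, n, ?_, eta_smeared b p f n⟩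
    rw [tsupport_shiftFn]
    exact fun u hu => ⟨_, hf hu, translate_translate_neg p u⟩
  exact h hA

theorem eta_image_localAlgebra (b : ℝ) (p : Cyl) (O : Set Cyl) :
    eta b p '' (localAlgebra b O : Set (Obs b)) = localAlgebra b (translate p '' O) := by
  apply Set.Subset.antisymm
  · rintro _ ⟨A, hA, rfl⟩
    exact eta_mem_localAlgebra p hA
  · intro A hA
    -- The reverse inclusion is the forward one for the inverse translation.
    have h := eta_mem_localAlgebra (-p) hA
    rw [Set.image_image] at h
    simp only [translate_neg_translate, Set.image_id'] at h
    exact ⟨_, h, eta_eta_neg b p A⟩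

end TimelikeLiouville
end

theorem proposition2p6 (b μ : ℝ) (hb : 0 < b) (hb' : b < 1 / Real.sqrt 2) (hμ : 0 < μ) :
    (TimelikeLiouville.eta b 0 = AlgHom.id ℂ (TimelikeLiouville.Obs b)
      ∧ (∀ p q : TimelikeLiouville.Cyl, TimelikeLiouville.eta b (p + q)
          = (TimelikeLiouville.eta b p).comp (TimelikeLiouville.eta b q))
      ∧ (∀ p : TimelikeLiouville.Cyl, Function.Bijective (TimelikeLiouville.eta b p)
          ∧ ∀ A : TimelikeLiouville.Obs b,
              TimelikeLiouville.eta b p (star A) = star (TimelikeLiouville.eta b p A)))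
    ∧ (∀ (p : TimelikeLiouville.Cyl) (A : TimelikeLiouville.Obs b),
        TimelikeLiouville.vacuum b μ (TimelikeLiouville.eta b p A)
          = TimelikeLiouville.vacuum b μ A)
    ∧ (∀ O₁ O₂ : Set TimelikeLiouville.Cyl, IsOpen O₁ → IsOpen O₂ → O₁ ⊆ O₂ →
        TimelikeLiouville.localAlgebra b O₁ ≤ TimelikeLiouville.localAlgebra b O₂)
    ∧ (∀ (p : TimelikeLiouville.Cyl) (O : Set TimelikeLiouville.Cyl), IsOpen O →
        TimelikeLiouville.eta b p '' (TimelikeLiouville.localAlgebra b O : Set _)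
          = (TimelikeLiouville.localAlgebra b (TimelikeLiouville.translate p '' O) : Set _))
    ∧ (∀ O : Set TimelikeLiouville.Cyl, IsOpen O →
        TimelikeLiouville.IsNormalizedHermitian (TimelikeLiouville.localVacuum b μ O)) := by
  open TimelikeLiouville in
  exact ⟨⟨eta_zero b, eta_add b, fun p =>
      ⟨⟨Function.LeftInverse.injective (eta_neg_eta b p),
        Function.RightInverse.surjective (eta_eta_neg b p)⟩, eta_star b p⟩⟩,
    vacuum_eta b μ, fun _ _ _ _ h => localAlgebra_mono b h,
    fun p O _ => eta_image_localAlgebra b p O,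
    fun _ _ => ⟨vacuum_one b μ, fun A => vacuum_star b μ A⟩⟩
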